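/- Let $f:\mathbb{C}\to\mathbb{C}$ be a transcendental entire function (entire and not a polynomial), and write $f^n$ for its $n$-th iterate. Let $F(f)$ be the Fatou set of $f$, i.e. the set of points having a neighbourhood on which the iterates $(f^n)$ form a normal family (with convergence to $\infty$ allowed), let $J(f)=\mathbb{C}\setminus F(f)$ be the Julia set, and let $I(f)=\{z: f^n(z)\to\infty \text{ as } n\to\infty\}$ be the escaping set. Let $D$ be a logarithmic tract of $f$. This means that $D\subset\mathbb{C}$ is an unbounded domain with unbounded complement (its boundary then automatically consists of piecewise smooth curves, since $f$ is entire) and that there is $R>0$ such that $|f(z)|=R$ for $z\in\partial D$, $|f(z)|>R$ for $z\in D$, and the restriction $f:D\to\{w\in\mathbb{C}:|w|>R\}$ is a universal covering. Then, for every sequence $(a_n)$ of positive real numbers with $a_n\to\infty$ as $n\to\infty$, there exist $\zeta\in I(f)\cap J(f)\cap\overline{D}$ and $N\in\mathbb{N}$ such that $$f^n(\zeta)\in\overline{D}\quad\text{for all } n\ge 1,\qquad\text{and}\qquad |f^n(\zeta)|\le a_n\quad\text{for all } n\ge N.$$ -/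

import Mathlib

open Set Filter Topology Bornology

/-- A transcendental entire function: entire and not a polynomial. -/
def IsTranscendentalEntire (f : ℂ → ℂ) : Prop :=
  Differentiable ℂ f ∧ ¬ ∃ p : Polynomial ℂ, ∀ z, f z = p.eval z

/-- The escaping set `I(f)`: the points whose orbit tends to `∞`. -/
def escapingSet (f : ℂ → ℂ) : Set ℂ :=
  {z | Tendsto (fun n : ℕ => f^[n] z) atTop (cobounded ℂ)}

/-- A family `F` of functions is normal on `U` (in the sense of Montel): every sequence in `F` has
a subsequence that converges, uniformly on compact subsets of `U`, either to a finite-valued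
function or to the constant `∞`. -/
def IsNormalFamilyOn (F : Set (ℂ → ℂ)) (U : Set ℂ) : Prop :=
  ∀ u : ℕ → ℂ → ℂ, (∀ n, u n ∈ F) → ∃ φ : ℕ → ℕ, StrictMono φ ∧
    ((∃ g : ℂ → ℂ, ∀ K ⊆ U, IsCompact K →
        TendstoUniformlyOn (fun n => u (φ n)) g atTop K) ∨
      (∀ K ⊆ U, IsCompact K → ∀ M : ℝ, ∀ᶠ n in atTop, ∀ z ∈ K, M < ‖u (φ n) z‖))

/-- The Fatou set `F(f)`: the points with a neighbourhood on which the iterates of `f` form a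
normal family. -/
def fatouSet (f : ℂ → ℂ) : Set ℂ :=
  {z | ∃ U : Set ℂ, IsOpen U ∧ z ∈ U ∧ IsNormalFamilyOn (Set.range fun n : ℕ => f^[n]) U}

/-- The Julia set `J(f)`. -/
def juliaSet (f : ℂ → ℂ) : Set ℂ := (fatouSet f)ᶜ

/-- `D` is a direct tract of the entire function `f`, with boundary value `R`: an unbounded
domain with unbounded complement such that `|f| = R` on the boundary of `D` and `|f| > R` in `D`.
As `f` is entire, it is holomorphic in `D` and continuous on the closure, and the boundary of `D`,
being contained in the level set `{|f| = R}`, automatically consists of piecewise smooth curves. -/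
structure IsDirectTract (f : ℂ → ℂ) (R : ℝ) (D : Set ℂ) : Prop where
  pos : 0 < R
  isOpen : IsOpen D
  isConnected : IsConnected D
  unbounded : ¬ IsBounded D
  compl_unbounded : ¬ IsBounded Dᶜ
  norm_eq : ∀ z ∈ frontier D, ‖f z‖ = R
  norm_gt : ∀ z ∈ D, R < ‖f z‖

/-- `D` is a logarithmic tract of the entire function `f`: it is a direct tract, for some boundary
value `R`, and the restriction `f : D → {w : |w| > R}` is a universal covering, that is, a covering
map with simply connected total space. -/
def IsLogarithmicTract (f : ℂ → ℂ) (D : Set ℂ) : Prop :=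
  ∃ (R : ℝ) (h : IsDirectTract f R D),
    SimplyConnectedSpace D ∧
    IsCoveringMap (MapsTo.restrict f D {w : ℂ | R < ‖w‖} h.norm_gt)

/-!
Let `g` be a logarithm of `f` on the tract `D`. Since `f : D → {|w| > R}` is a universal covering,
`g` maps `D` conformally onto the half-plane `{Re s > log R}`; its inverse `ψ` is the lift of `exp`
through `f` (`exists_conformal_logarithm`). On a smaller half-plane `{Re s > L}`, where
`|f ∘ ψ| > |f 0|`, the function `ψ` has no zeros, so it has a logarithm `Φ`. As `ψ` is injective,
`Φ` never takes two values that differ by `2πi`, and a weak form of Bloch's theorem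
(`norm_deriv_mul_le_of_forall_ne_add_two_pi_I`) gives the key estimate
`|Φ' s| ≤ 1000 / (Re s - L)`: in logarithmic coordinates, `f` is strongly expanding far out in the
tract. The estimate is used twice.

*Slow escape.* The preimages in `D` of a point `w` are the points `ψ (log w + 2πik)`. Since `Φ` grows
more slowly than `Re s`, the preimage with `k = 0` is much smaller than `w`; the preimages tend to
`∞`, and the estimate shows that the modulus at most doubles from one to the next. So, for large
`r`, every `w` with `r ≤ |w| ≤ 4r` has a preimage in `D ∩ {r ≤ |z| ≤ 2r}`
(`IsLogarithmicCoordinate.exists_forall_exists_mem_annulus`). Hence the part of the closure of `D` in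
an annulus `{ρ ≤ |z| ≤ 2ρ}` covers its counterpart for the same `ρ`, and also the one for `2ρ`. A
compactness argument (`exists_forall_iterate_mem`) then yields an orbit that waits in each annulus for
as long as the given sequence requires (`exists_slow_sequence`) before moving on.

*Julia set.* If such a point `ζ` were in the Fatou set, the iterates would tend to `∞` uniformly on a
disc about `ζ`, and so map it into `D` from some index on. There `f^[n]` has the logarithm
`K n = Φ ∘ g ∘ f^[n]`, again with no two values differing by `2πi`, so that `(K n)' ζ` is bounded.
The expansion gives `|(K n)' ζ| ≤ |(K (n + 1))' ζ| / 10`, so `(K n)' ζ = 0`; but `f` has no critical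
points on the orbit (`IsLogarithmicCoordinate.mem_juliaSet`).
-/

/-! ### A weak form of Bloch's theorem -/

/-- A form of Bloch's theorem, with a crude constant: if `‖h' a‖ * ρ` is large, the image
contains a disc of radius larger than `2π`, hence two points that differ by `2πi`. -/
theorem norm_deriv_mul_le_of_forall_ne_add_two_pi_I {h : ℂ → ℂ} {a : ℂ} {ρ : ℝ} (hρ : 0 < ρ)
    (hd : DifferentiableOn ℂ h (Metric.ball a ρ))
    (hne : ∀ z ∈ Metric.ball a ρ, ∀ w ∈ Metric.ball a ρ, h w ≠ h z + 2 * Real.pi * Complex.I) :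
    ‖deriv h a‖ * ρ ≤ 1000 := by
  by_contra! hlt
  set q := ρ / 2 with hq
  have hq0 : 0 < q := by positivity
  have hd' : DifferentiableOn ℂ (deriv h) (Metric.ball a ρ) := hd.deriv Metric.isOpen_ball
  have hsub : Metric.closedBall a q ⊆ Metric.ball a ρ :=
    Metric.closedBall_subset_ball (by linarith)
  -- Around the point `z₁` where `‖h' z‖ * (q - dist z a)` is maximal, `‖h'‖` is at most twice its
  -- value at `z₁`, on a disc of radius `t`.
  obtain ⟨z₁, hz₁, hmax⟩ := (isCompact_closedBall a q).exists_isMaxOn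
    (f := fun z ↦ ‖deriv h z‖ * (q - dist z a)) ⟨a, by simp [hq0.le]⟩
    ((hd'.continuousOn.mono hsub).norm.mul (by fun_prop))
  rw [isMaxOn_iff] at hmax
  set m := ‖deriv h z₁‖ with hm
  obtain ⟨t, ht⟩ : ∃ t, t = (q - dist z₁ a) / 2 := ⟨_, rfl⟩
  have hmt : 250 < m * t := by
    have := hmax a (by simp [hq0.le])
    simp only [dist_self, sub_zero] at this
    have h1 : ‖deriv h a‖ * ρ = 2 * (‖deriv h a‖ * q) := by rw [hq]; ring
    have h2 : m * (q - dist z₁ a) = 2 * (m * t) := by rw [ht]; ring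
    linarith
  have ht0 : 0 < t := by
    have h1 : 0 ≤ t := by rw [ht]; linarith [Metric.mem_closedBall.1 hz₁]
    rcases h1.eq_or_lt with h1 | h1
    · rw [← h1] at hmt; norm_num at hmt
    · exact h1
  have hm0 : 0 < m := by
    by_contra! hm0
    nlinarith
  have hbt : Metric.ball z₁ t ⊆ Metric.closedBall a q := by
    intro z hz
    rw [Metric.mem_closedBall]
    linarith [dist_triangle z z₁ a, Metric.mem_ball.1 hz]
  have hb2 : ∀ z ∈ Metric.ball z₁ t, ‖deriv h z‖ ≤ 2 * m := by
    intro z hz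
    have h1 := hmax z (hbt hz)
    have h2 : t ≤ q - dist z a := by linarith [dist_triangle z z₁ a, Metric.mem_ball.1 hz]
    have h3 : ‖deriv h z‖ * t ≤ 2 * m * t := by
      calc ‖deriv h z‖ * t ≤ ‖deriv h z‖ * (q - dist z a) := by gcongr
        _ ≤ _ := h1
        _ = 2 * m * t := by rw [ht]; ring
    exact le_of_mul_le_mul_right h3 ht0
  -- By the Schwarz lemma for `h'`, the map `h` is nearly linear on the disc of radius `t / 8`.
  have hschw : ∀ z ∈ Metric.ball z₁ t, ‖deriv h z - deriv h z₁‖ ≤ 3 * m / t * dist z z₁ := by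
    intro z hz
    rw [← dist_eq_norm]
    refine Complex.dist_le_div_mul_dist_of_mapsTo_ball (hd'.mono (hbt.trans hsub)) ?_ hz
    intro w hw
    rw [Metric.mem_closedBall, dist_eq_norm]
    linarith [norm_sub_le (deriv h w) (deriv h z₁), hb2 w hw]
  have hs8 : Metric.closedBall z₁ (t / 8) ⊆ Metric.ball z₁ t :=
    Metric.closedBall_subset_ball (by linarith)
  have hdiff : ∀ z ∈ Metric.closedBall z₁ (t / 8), DifferentiableAt ℂ h z := fun z hz ↦
    hd.differentiableAt (Metric.isOpen_ball.mem_nhds (hsub (hbt (hs8 hz))))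
  have hz₁mem : z₁ ∈ Metric.closedBall z₁ (t / 8) := by simp; positivity
  have hlow : ∀ z ∈ Metric.sphere z₁ (t / 8), 5 * (m * t) / 64 ≤ ‖h z - h z₁‖ := by
    intro z hz
    have hmv := (convex_closedBall z₁ (t / 8)).norm_image_sub_le_of_norm_deriv_le
      (f := fun z ↦ h z - deriv h z₁ * z) (C := 3 * m / 8) (x := z₁) (y := z)
      (fun w hw ↦ (hdiff w hw).sub (by fun_prop)) (fun w hw ↦ by
        have : HasDerivAt (fun z ↦ h z - deriv h z₁ * z) (deriv h w - deriv h z₁) w := by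
          have h1 := (hasDerivAt_id w).const_mul (deriv h z₁)
          rw [mul_one] at h1
          exact (hdiff w hw).hasDerivAt.sub h1
        rw [this.deriv]
        refine (hschw w (hs8 hw)).trans ?_
        have := Metric.mem_closedBall.1 hw
        calc 3 * m / t * dist w z₁ ≤ 3 * m / t * (t / 8) := by gcongr
          _ = 3 * m / 8 := by field_simp) hz₁mem (Metric.sphere_subset_closedBall hz)
    have hz8 : ‖z - z₁‖ = t / 8 := by rw [← dist_eq_norm]; exact hz
    have h1 : ‖deriv h z₁ * (z - z₁)‖ = m * (t / 8) := by rw [norm_mul, hz8]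
    have h2 : deriv h z₁ * (z - z₁) =
        (h z - h z₁) - ((h z - deriv h z₁ * z) - (h z₁ - deriv h z₁ * z₁)) := by ring
    have h3 := norm_sub_le (h z - h z₁) ((h z - deriv h z₁ * z) - (h z₁ - deriv h z₁ * z₁))
    rw [← h2, h1] at h3
    rw [hz8] at hmv
    linarith
  have hball := DiffContOnCl.ball_subset_image_closedBall (f := h) (z₀ := z₁) (r := t / 8)
    ((hd.mono ((Metric.closedBall_subset_ball (by linarith)).trans
      (hbt.trans hsub))).diffContOnCl_ball subset_rfl)
    (by positivity) hlow (by
      have := (hdiff z₁ hz₁mem).hasDerivAt.eventually_ne (c := h z₁) (norm_pos_iff.1 hm0)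
      exact this.frequently.filter_mono nhdsWithin_le_nhds)
  have h2pi : h z₁ + 2 * Real.pi * Complex.I ∈ Metric.ball (h z₁) (5 * (m * t) / 64 / 2) := by
    rw [Metric.mem_ball, dist_eq_norm, add_sub_cancel_left]
    simp only [norm_mul, Complex.norm_ofNat, Complex.norm_real, Complex.norm_I, mul_one,
      Real.norm_eq_abs, abs_of_pos Real.pi_pos]
    linarith [Real.pi_lt_d2]
  obtain ⟨w, hw, hw2⟩ := hball h2pi
  exact hne z₁ (hsub hz₁) w (hsub (hbt (hs8 hw))) hw2

/-! ### Holomorphic logarithms and inverses -/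

theorem differentiableOn_of_exp_comp {g f : ℂ → ℂ} {U : Set ℂ} (hU : IsOpen U)
    (hg : ContinuousOn g U) (hf : DifferentiableOn ℂ f U) (hgf : ∀ z ∈ U, Complex.exp (g z) = f z) :
    DifferentiableOn ℂ g U := by
  intro z hz
  have hn := hU.mem_nhds hz
  refine (HasDerivAt.of_comp_left (f := Complex.exp) (h := f) (hg.continuousAt hn)
    (Complex.hasDerivAt_exp _) (hf.differentiableAt hn).hasDerivAt (Complex.exp_ne_zero _) ?_
    ).differentiableAt.differentiableWithinAt
  filter_upwards [hn] with w hw using hgf w hw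

theorem exists_differentiableOn_exp_eq {U : Set ℂ} (hU : IsOpen U) (hUc : IsSimplyConnected U)
    {f : ℂ → ℂ} (hf : DifferentiableOn ℂ f U) (h0 : ∀ z ∈ U, f z ≠ 0) :
    ∃ g : ℂ → ℂ, DifferentiableOn ℂ g U ∧ ∀ z ∈ U, Complex.exp (g z) = f z := by
  obtain ⟨g, hg, hgf⟩ := Complex.exists_continuousOn_eqOn_exp_comp hUc hU hf.continuousOn
    (by rintro ⟨z, hz, h⟩; exact h0 z hz h)
  exact ⟨g, differentiableOn_of_exp_comp hU hg hf hgf, hgf⟩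

theorem isSimplyConnected_setOf_lt_re (c : ℝ) : IsSimplyConnected {s : ℂ | c < s.re} := by
  have : ContractibleSpace {s : ℂ | c < s.re} :=
    (convex_halfSpace_re_gt c).contractibleSpace ⟨(c + 1 : ℝ), by simp⟩
  exact SimplyConnectedSpace.ofContractible _

theorem isOpen_setOf_lt_re (c : ℝ) : IsOpen {s : ℂ | c < s.re} :=
  isOpen_lt continuous_const Complex.continuous_re

/-- The continuous inverse `ψ` of a holomorphic bijection `g` is holomorphic. The zeros of `g'` are
isolated, as `g` is injective, and continuity makes the corresponding singularities of `ψ`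
removable. -/
theorem differentiableOn_of_inverse {g ψ : ℂ → ℂ} {D H : Set ℂ} (hD : IsOpen D) (hH : IsOpen H)
    (hg : DifferentiableOn ℂ g D) (hψ : ContinuousOn ψ H) (hmaps : MapsTo ψ H D)
    (hgψ : ∀ s ∈ H, g (ψ s) = s) (hψg : ∀ z ∈ D, ψ (g z) = z) : DifferentiableOn ℂ ψ H := by
  intro s hs
  refine (Complex.analyticAt_of_differentiable_on_punctured_nhds_of_continuousAt ?_
    (hψ.continuousAt (hH.mem_nhds hs))).differentiableAt.differentiableWithinAt
  have hz := hD.mem_nhds (hmaps hs)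
  have hne : ∀ᶠ z in 𝓝[≠] (ψ s), deriv g z ≠ 0 := by
    rcases ((hg.deriv hD).analyticAt hz).eventually_eq_zero_or_eventually_ne_zero with h | h
    · exfalso
      -- If `g'` vanished near `ψ s`, then `g` would be constant there, but `g` is injective on `D`.
      obtain ⟨ε, hε, hb⟩ := Metric.eventually_nhds_iff_ball.1 (h.and hz)
      have hconst : ∀ z ∈ Metric.ball (ψ s) ε, g z = g (ψ s) := fun z hz' ↦
        Metric.isOpen_ball.is_const_of_deriv_eq_zero (convex_ball _ _).isPreconnected
          (hg.mono fun w hw ↦ (hb w hw).2) (fun w hw ↦ (hb w hw).1) hz' (Metric.mem_ball_self hε)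
      have hmem : ψ s + (ε / 2 : ℝ) ∈ Metric.ball (ψ s) ε := by
        simp [abs_of_pos hε]; linarith
      have h1 := congrArg ψ (hconst _ hmem)
      rw [hψg _ (hb _ hmem).2, hψg _ (hmaps hs)] at h1
      have : (ε / 2 : ℝ) = 0 := by
        exact_mod_cast add_eq_left.1 h1
      linarith
    · exact h
  have hcont : Tendsto ψ (𝓝[≠] s) (𝓝[≠] (ψ s)) := by
    refine tendsto_nhdsWithin_iff.2
      ⟨(hψ.continuousAt (hH.mem_nhds hs)).tendsto.mono_left nhdsWithin_le_nhds, ?_⟩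
    filter_upwards [mem_nhdsWithin_of_mem_nhds (hH.mem_nhds hs), self_mem_nhdsWithin]
      with t ht hts h
    exact hts (by rw [mem_singleton_iff, ← hgψ t ht, h, hgψ s hs])
  filter_upwards [mem_nhdsWithin_of_mem_nhds (hH.mem_nhds hs), hcont.eventually hne] with t ht ht'
  refine (HasDerivAt.of_local_left_inverse (f := g) (hψ.continuousAt (hH.mem_nhds ht))
    (hg.differentiableAt (hD.mem_nhds (hmaps ht))).hasDerivAt ht' ?_).differentiableAt
  filter_upwards [hH.mem_nhds ht] with u hu using hgψ u hu

/-! ### The conformal map from a half-plane onto a logarithmic tract -/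

/-- A logarithm `g` of `f` on a logarithmic tract is a conformal map onto a half-plane, with
inverse `ψ`. -/
theorem exists_conformal_logarithm {f : ℂ → ℂ} (hf : Differentiable ℂ f) {D : Set ℂ}
    (hD : IsLogarithmicTract f D) :
    ∃ (R : ℝ) (g ψ : ℂ → ℂ), IsDirectTract f R D ∧ DifferentiableOn ℂ g D ∧
      DifferentiableOn ℂ ψ {s | Real.log R < s.re} ∧ (∀ z ∈ D, Complex.exp (g z) = f z) ∧
      MapsTo g D {s | Real.log R < s.re} ∧
      MapsTo ψ {s | Real.log R < s.re} D ∧ (∀ s : ℂ, Real.log R < s.re → g (ψ s) = s) ∧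
      ∀ z ∈ D, ψ (g z) = z := by
  obtain ⟨R, h, hsc, hcov⟩ := hD
  have hR := h.pos
  have hexp : ∀ s : ℂ, Real.log R < s.re ↔ R < ‖Complex.exp s‖ := fun s ↦ by
    rw [Complex.norm_exp, Real.log_lt_iff_lt_exp hR]
  obtain ⟨g, hg, hgf⟩ := exists_differentiableOn_exp_eq h.isOpen hsc hf.differentiableOn
    (fun z hz ↦ norm_pos_iff.1 (hR.trans (h.norm_gt z hz)))
  set H : Set ℂ := {s | Real.log R < s.re} with hH
  have hHo : IsOpen H := isOpen_setOf_lt_re _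
  have hgH : MapsTo g D H := fun z hz ↦ (hexp _).2 (by rw [hgf z hz]; exact h.norm_gt z hz)
  have : SimplyConnectedSpace H := isSimplyConnected_setOf_lt_re _
  have : LocallyPathConnectedSpace H := hHo.locallyPathConnectedSpace
  have : PreconnectedSpace D := isPreconnected_iff_preconnectedSpace.1 h.isConnected.isPreconnected
  obtain ⟨z₀, hz₀⟩ := h.isConnected.nonempty
  let E : C(H, {w : ℂ | R < ‖w‖}) :=
    ⟨fun s ↦ ⟨Complex.exp s, (hexp s).1 s.2⟩, by fun_prop⟩
  obtain ⟨F, ⟨hF0, hFE⟩, -⟩ := hcov.existsUnique_continuousMap_lifts E ⟨g z₀, hgH hz₀⟩ ⟨z₀, hz₀⟩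
    (Subtype.ext (hgf z₀ hz₀).symm)
  have hfF : ∀ s : H, f (F s) = Complex.exp s := fun s ↦ congrArg Subtype.val (congrFun hFE s)
  let G : D → H := fun z ↦ ⟨g z, hgH z.2⟩
  have hG : Continuous G :=
    (continuousOn_iff_continuous_domRestrict.1 hg.continuousOn).subtype_mk _
  -- `F ∘ G` and the identity of `D` are lifts of `f` through `f`; the other composite and the
  -- inclusion of `H` are lifts of `exp` through `exp`.
  have hFG : F ∘ G = id := by
    refine hcov.eq_of_comp_eq (F.continuous.comp hG) continuous_id ?_ ⟨z₀, hz₀⟩ hF0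
    ext z
    exact (hfF _).trans (hgf z z.2)
  have hGF : (fun s : H ↦ g (F s)) = fun s : H ↦ (s : ℂ) := by
    refine Complex.isCoveringMap_exp.eq_of_comp_eq
      (continuous_subtype_val.comp (hG.comp F.continuous)) continuous_subtype_val ?_
      ⟨g z₀, hgH hz₀⟩ (congrArg (fun z : D ↦ g z) hF0)
    ext s
    exact (hgf _ (F s).2).trans (hfF s)
  classical
  let ψ : ℂ → ℂ := fun s ↦ if hs : s ∈ H then F ⟨s, hs⟩ else 0
  have hψ : ∀ s (hs : s ∈ H), ψ s = F ⟨s, hs⟩ := fun s hs ↦ dif_pos hs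
  have hψD : MapsTo ψ H D := fun s hs ↦ by rw [hψ s hs]; exact (F ⟨s, hs⟩).2
  have hψc : ContinuousOn ψ H := by
    rw [continuousOn_iff_continuous_domRestrict]
    have : H.domRestrict ψ = fun s ↦ (F s : ℂ) := funext fun s ↦ hψ s s.2
    rw [this]
    fun_prop
  have hgψ : ∀ s ∈ H, g (ψ s) = s := fun s hs ↦ by
    rw [hψ s hs]; exact congrFun hGF ⟨s, hs⟩
  have hψg : ∀ z ∈ D, ψ (g z) = z := fun z hz ↦ by
    rw [hψ _ (hgH hz)]; exact congrArg Subtype.val (congrFun hFG ⟨z, hz⟩)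
  exact ⟨R, g, ψ, h, hg, differentiableOn_of_inverse h.isOpen hHo hg hψc hψD hgψ hψg, hgf, hgH,
    hψD, hgψ, hψg⟩

/-- A zero-free injective function on a half-plane has a logarithm whose derivative decays like the
inverse of the distance to the boundary: by injectivity, the logarithm does not take two values that
differ by `2πi`. -/
theorem exists_log_of_injOn_halfPlane {ψ : ℂ → ℂ} {L : ℝ}
    (hψ : DifferentiableOn ℂ ψ {s | L < s.re}) (hinj : InjOn ψ {s | L < s.re})
    (h0 : ∀ s : ℂ, L < s.re → ψ s ≠ 0) :
    ∃ Φ : ℂ → ℂ, DifferentiableOn ℂ Φ {s | L < s.re} ∧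
      (∀ s : ℂ, L < s.re → Complex.exp (Φ s) = ψ s) ∧
      ∀ s : ℂ, L < s.re → ‖deriv Φ s‖ * (s.re - L) ≤ 1000 := by
  obtain ⟨Φ, hΦ, hexp⟩ := exists_differentiableOn_exp_eq (isOpen_setOf_lt_re L)
    (isSimplyConnected_setOf_lt_re L) hψ h0
  refine ⟨Φ, hΦ, hexp, fun s hs ↦ ?_⟩
  have hsub : Metric.ball s (s.re - L) ⊆ {s | L < s.re} := by
    intro z hz
    have := (Complex.abs_re_le_norm (z - s)).trans_lt (mem_ball_iff_norm.1 hz)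
    rw [Complex.sub_re, abs_lt] at this
    simp only [mem_ofPred_eq]
    linarith
  refine norm_deriv_mul_le_of_forall_ne_add_two_pi_I (sub_pos.2 hs) (hΦ.mono hsub) ?_
  intro z hz w hw hzw
  have h1 : w = z := hinj (hsub hw) (hsub hz) (by
    rw [← hexp w (hsub hw), ← hexp z (hsub hz), hzw, Complex.exp_periodic])
  rw [h1, eq_comm, add_eq_left] at hzw
  exact Complex.two_pi_I_ne_zero hzw

/-- Logarithmic coordinates on the tract `D` of `f`: `g` is a logarithm of `f` on `D`, `ψ` is its
inverse, and `Φ` is a logarithm of `ψ`. The statements on `ψ` and `Φ` are required only on a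
half-plane `{Re s > L}`, possibly smaller than the image of `g`, because `D` may contain `0`, at whose
image under `g` the function `ψ` has a zero. -/
structure IsLogarithmicCoordinate (f : ℂ → ℂ) (D : Set ℂ) (L : ℝ) (g ψ Φ : ℂ → ℂ) : Prop where
  differentiableOn_g : DifferentiableOn ℂ g D
  exp_g : ∀ z ∈ D, Complex.exp (g z) = f z
  differentiableOn_Φ : DifferentiableOn ℂ Φ {s | L < s.re}
  mapsTo_ψ : MapsTo ψ {s | L < s.re} D
  g_ψ : ∀ s : ℂ, L < s.re → g (ψ s) = s
  ψ_g : ∀ z ∈ D, ψ (g z) = z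
  exp_Φ : ∀ s : ℂ, L < s.re → Complex.exp (Φ s) = ψ s
  norm_deriv_Φ_le : ∀ s : ℂ, L < s.re → ‖deriv Φ s‖ * (s.re - L) ≤ 1000

theorem exists_isLogarithmicCoordinate {f : ℂ → ℂ} (hf : Differentiable ℂ f) {D : Set ℂ}
    (hD : IsLogarithmicTract f D) :
    ∃ (R L : ℝ) (g ψ Φ : ℂ → ℂ), IsDirectTract f R D ∧ IsLogarithmicCoordinate f D L g ψ Φ := by
  obtain ⟨R, g, ψ, h, hg, hψ, hexp, hgH, hψD, hgψ, hψg⟩ := exists_conformal_logarithm hf hD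
  have hM : 0 < max R ‖f 0‖ := lt_max_of_lt_left h.pos
  set L := Real.log (max R ‖f 0‖) with hL
  have hRL : {s : ℂ | L < s.re} ⊆ {s : ℂ | Real.log R < s.re} := fun s hs ↦
    (Real.log_le_log h.pos (le_max_left _ _)).trans_lt hs
  obtain ⟨Φ, hΦ, hΦexp, hΦ'⟩ := exists_log_of_injOn_halfPlane (L := L) (hψ.mono hRL)
    (fun s hs t ht hst ↦ by rw [← hgψ s (hRL hs), hst, hgψ t (hRL ht)])
    (fun s hs h0 ↦ by
      -- `f (ψ s) = exp s` has modulus larger than `‖f 0‖`.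
      have h1 : ‖f (ψ s)‖ = Real.exp s.re := by
        rw [← hexp _ (hψD (hRL hs)), hgψ s (hRL hs), Complex.norm_exp]
      rw [hL, Real.log_lt_iff_lt_exp hM, ← h1, h0] at hs
      exact absurd hs (not_lt.2 (le_max_right _ _)))
  exact ⟨R, L, g, ψ, Φ, h, hg, hexp, hΦ, hψD.mono_left hRL, fun s hs ↦ hgψ s (hRL hs), hψg, hΦexp,
    hΦ'⟩

/-! ### Covering of annuli inside the tract -/

theorem finite_inter_preimage_singleton {f : ℂ → ℂ} (hf : Differentiable ℂ f) {K : Set ℂ}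
    (hK : IsCompact K) {w z₀ : ℂ} (hz₀ : f z₀ ≠ w) : (K ∩ f ⁻¹' {w}).Finite := by
  by_contra hinf
  obtain ⟨z, -, hz⟩ := Set.Infinite.exists_accPt_of_subset_isCompact hinf hK inter_subset_left
  have hfreq : ∃ᶠ y in 𝓝[≠] z, f y = w :=
    (accPt_iff_frequently_nhdsNE.1 hz).mono fun y hy ↦ hy.2
  have han : AnalyticOnNhd ℂ f univ := fun z _ ↦ hf.analyticAt z
  exact hz₀ (congrFun (han.eq_of_frequently_eq (fun _ _ ↦ analyticAt_const) hfreq) z₀)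

namespace IsLogarithmicCoordinate

variable {f : ℂ → ℂ} {D : Set ℂ} {L : ℝ} {g ψ Φ : ℂ → ℂ}

theorem f_ψ (h : IsLogarithmicCoordinate f D L g ψ Φ) {s : ℂ} (hs : L < s.re) :
    f (ψ s) = Complex.exp s := by
  rw [← h.exp_g _ (h.mapsTo_ψ hs), h.g_ψ s hs]

/-- The bound `1 / 10` makes `‖ψ s‖` at most double when `s` moves by `2πi`, as
`2π / 10 < log 2`. -/
theorem norm_deriv_Φ_le_of_le (h : IsLogarithmicCoordinate f D L g ψ Φ) {s : ℂ}
    (hs : L + 10000 ≤ s.re) : ‖deriv Φ s‖ ≤ 1 / 10 := by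
  have h1 := h.norm_deriv_Φ_le s (by linarith)
  have h2 : ‖deriv Φ s‖ * 10000 ≤ ‖deriv Φ s‖ * (s.re - L) := by gcongr; linarith
  linarith

theorem norm_Φ_sub_le (h : IsLogarithmicCoordinate f D L g ψ Φ) {s t : ℂ}
    (hs : L + 10000 ≤ s.re) (ht : L + 10000 ≤ t.re) : ‖Φ s - Φ t‖ ≤ 1 / 10 * ‖s - t‖ :=
  (convex_halfSpace_re_ge (L + 10000)).norm_image_sub_le_of_norm_deriv_le
    (fun u hu ↦ h.differentiableOn_Φ.differentiableAt
      ((isOpen_setOf_lt_re L).mem_nhds ((show L < L + 10000 by linarith).trans_le hu)))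
    (fun _ hu ↦ h.norm_deriv_Φ_le_of_le hu) ht hs

/-- Every point of a large annulus `{r ≤ |w| ≤ 4r}` has a preimage in `D ∩ {r ≤ |z| ≤ 2r}`. -/
theorem exists_forall_exists_mem_annulus (h : IsLogarithmicCoordinate f D L g ψ Φ)
    (hf : Differentiable ℂ f) : ∃ r₀ : ℝ, ∀ r, r₀ ≤ r → ∀ w : ℂ, r ≤ ‖w‖ → ‖w‖ ≤ 4 * r →
      ∃ z ∈ D, r ≤ ‖z‖ ∧ ‖z‖ ≤ 2 * r ∧ f z = w := by
  set x₀ : ℝ := L + 10000 with hx₀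
  set A : ℝ := 2 * ‖Φ x₀‖ + |x₀| + 10 with hA
  refine ⟨Real.exp A, fun r hr w hrw hw ↦ ?_⟩
  have hr0 : 0 < r := (Real.exp_pos _).trans_le hr
  have hw0 : w ≠ 0 := norm_pos_iff.1 (hr0.trans_le hrw)
  have hlr : A ≤ Real.log r := (Real.le_log_iff_exp_le hr0).2 hr
  have hx₀A : x₀ ≤ A := by linarith [le_abs_self x₀, norm_nonneg (Φ x₀)]
  set s := Complex.log w with hs
  have hsre : s.re = Real.log ‖w‖ := Complex.log_re w
  have hlw : Real.log r ≤ s.re := by rw [hsre]; exact Real.log_le_log hr0 hrw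
  have hlw4 : s.re ≤ Real.log r + 2 := by
    rw [hsre]
    have h1 := Real.log_le_log (norm_pos_iff.2 hw0) hw
    have h2 : Real.log 4 = 2 * Real.log 2 := by
      rw [show (4 : ℝ) = 2 ^ 2 by norm_num, Real.log_pow]; norm_num
    rw [Real.log_mul (by norm_num) hr0.ne', h2] at h1
    linarith [Real.log_two_lt_d9]
  -- The points `ψ (u k)` are preimages of `w`.
  set u : ℕ → ℂ := fun k ↦ s + k * (2 * Real.pi * Complex.I) with hu
  have hure : ∀ k, (u k).re = s.re := fun k ↦ by simp [hu]
  have huge : ∀ k, x₀ ≤ (u k).re := fun k ↦ by rw [hure]; linarith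
  have hugt : ∀ k, L < (u k).re := fun k ↦ by linarith [huge k]
  have hfu : ∀ k, f (ψ (u k)) = w := fun k ↦ by
    rw [h.f_ψ (hugt k), hu, Complex.exp_periodic.nat_mul k s, hs, Complex.exp_log hw0]
  have hnorm : ∀ k, ‖ψ (u k)‖ = Real.exp (Φ (u k)).re := fun k ↦ by
    rw [← h.exp_Φ _ (hugt k), Complex.norm_exp]
  have hψ0 : ‖ψ (u 0)‖ ≤ r := by
    rw [hnorm, ← Real.le_log_iff_exp_le hr0]
    have h1 := h.norm_Φ_sub_le (s := u 0) (t := x₀) (huge 0) (by simp [hx₀])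
    have h2 : ‖u 0 - x₀‖ ≤ (s.re - x₀) + Real.pi := by
      refine (Complex.norm_le_abs_re_add_abs_im _).trans (add_le_add ?_ ?_)
      · rw [Complex.sub_re, hure, Complex.ofReal_re, abs_of_nonneg (by linarith)]
      · simpa [hu, hs, Complex.log_im] using Complex.abs_arg_le_pi w
    have h3 : ‖Φ (u 0)‖ ≤ ‖Φ x₀‖ + ‖Φ (u 0) - Φ x₀‖ := by
      simpa using norm_add_le (Φ x₀) (Φ (u 0) - Φ x₀)
    have h4 := Complex.re_le_norm (Φ (u 0))
    linarith [Real.pi_lt_four, neg_abs_le x₀, norm_nonneg (Φ x₀)]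
  have hstep : ∀ k, ‖ψ (u (k + 1))‖ ≤ 2 * ‖ψ (u k)‖ := fun k ↦ by
    have h1 := h.norm_Φ_sub_le (huge (k + 1)) (huge k)
    have h2 : u (k + 1) - u k = 2 * Real.pi * Complex.I := by simp only [hu]; push_cast; ring
    have h3 : ‖u (k + 1) - u k‖ = 2 * Real.pi := by
      rw [h2]; simp [abs_of_pos Real.pi_pos]
    have h4 := Complex.re_le_norm (Φ (u (k + 1)) - Φ (u k))
    rw [Complex.sub_re] at h4
    rw [hnorm, hnorm, ← Real.exp_log (show (0 : ℝ) < 2 by norm_num), ← Real.exp_add,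
      Real.exp_le_exp]
    linarith [Real.pi_lt_d2, Real.log_two_gt_d9]
  -- The fibre over `w` is infinite, and only finitely many of its points are in a given disc.
  have hex : ∃ k, r ≤ ‖ψ (u k)‖ := by
    by_contra! hlt
    have hinj : Function.Injective fun k ↦ ψ (u k) := fun j k hjk ↦ by
      have h1 : u j = u k := by
        rw [← h.g_ψ _ (hugt j), ← h.g_ψ _ (hugt k)]; exact congrArg g hjk
      exact_mod_cast mul_right_cancel₀ Complex.two_pi_I_ne_zero (add_left_cancel h1)
    have hne : f (ψ (u 0 + 1)) ≠ w := fun h1 ↦ by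
      have h2 := congrArg norm h1
      have h3 : L < (u 0 + 1).re := by
        rw [Complex.add_re, Complex.one_re]; linarith [hugt 0]
      rw [h.f_ψ h3, Complex.norm_exp, Complex.add_re, hure, hsre, Complex.one_re, Real.exp_add,
        Real.exp_log (norm_pos_iff.2 hw0)] at h2
      nlinarith [Real.add_one_lt_exp one_ne_zero, norm_pos_iff.2 hw0]
    refine Set.infinite_range_of_injective hinj
      ((finite_inter_preimage_singleton hf (isCompact_closedBall 0 r) hne).subset ?_)
    rintro _ ⟨k, rfl⟩
    exact ⟨by simpa using (hlt k).le, hfu k⟩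
  classical
  refine ⟨ψ (u (Nat.find hex)), h.mapsTo_ψ (hugt _), Nat.find_spec hex, ?_, hfu _⟩
  rcases hk : Nat.find hex with _ | k
  · linarith
  · have h1 := Nat.find_min hex (m := k) (by omega)
    linarith [hstep k]

end IsLogarithmicCoordinate

/-! ### Orbits with a prescribed itinerary -/

/-- For any sequence `b`, there is a sequence of natural numbers that tends to `∞` in steps of at
most `1`, so slowly that `b (m n) ≤ a n` eventually. -/
theorem exists_slow_sequence {a : ℕ → ℝ} (ha : Tendsto a atTop atTop) (b : ℕ → ℝ) :
    ∃ m : ℕ → ℕ, Tendsto m atTop atTop ∧ Monotone m ∧ (∀ n, m (n + 1) ≤ m n + 1) ∧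
      ∀ᶠ n in atTop, b (m n) ≤ a n := by
  classical
  -- Increase `m` by one as soon as all later terms of `a` allow it.
  let m : ℕ → ℕ := fun n ↦ n.rec 0 fun n k ↦ if ∀ j, n + 1 ≤ j → b (k + 1) ≤ a j then k + 1 else k
  have hm : ∀ n, m (n + 1) = if ∀ j, n + 1 ≤ j → b (m n + 1) ≤ a j then m n + 1 else m n :=
    fun n ↦ rfl
  have hle : ∀ n, m n ≤ m (n + 1) := fun n ↦ by rw [hm]; split_ifs <;> omega
  have hmono : Monotone m := monotone_nat_of_le_succ hle
  refine ⟨m, ?_, hmono, fun n ↦ by rw [hm]; split_ifs <;> omega, ?_⟩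
  · refine tendsto_atTop_atTop_of_monotone hmono fun k ↦ ?_
    induction k with
    | zero => exact ⟨0, Nat.zero_le _⟩
    | succ k ih =>
      obtain ⟨n, hn⟩ := ih
      obtain ⟨N, hN⟩ := eventually_atTop.1 (ha.eventually_ge_atTop (b (k + 1)))
      refine ⟨max n N + 1, ?_⟩
      have h1 := hn.trans (hmono (le_max_left n N))
      rcases h1.eq_or_lt with h1 | h1
      · rw [hm, if_pos, ← h1]
        intro j hj
        rw [← h1]
        exact hN j (by omega)
      · exact (Nat.succ_le_of_lt h1).trans (hle _)
  · obtain ⟨N, hN⟩ := eventually_atTop.1 (ha.eventually_ge_atTop (b 0))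
    have hinv : ∀ n, (∀ j, n ≤ j → b (m n) ≤ a j) ∨ m n = 0 := by
      intro n
      induction n with
      | zero => exact Or.inr rfl
      | succ n ih =>
        rw [hm]
        split_ifs with h
        · exact Or.inl h
        · exact ih.imp_left fun h j hj ↦ h j (by omega)
    filter_upwards [eventually_ge_atTop N] with n hn
    rcases hinv n with h | h
    · exact h n le_rfl
    · rw [h]; exact hN n hn

theorem exists_forall_iterate_mem {X : Type*} [TopologicalSpace X] [T2Space X] {f : X → X}
    (hf : Continuous f)
    {E : ℕ → Set X} (hE : ∀ n, IsCompact (E n)) (hne : ∀ n, (E n).Nonempty)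
    (hsub : ∀ n, E (n + 1) ⊆ f '' E n) : ∃ x, ∀ n, f^[n] x ∈ E n := by
  have hback : ∀ N, ∀ w ∈ E N, ∃ x, f^[N] x = w ∧ ∀ n ≤ N, f^[n] x ∈ E n := by
    intro N
    induction N with
    | zero => exact fun w hw ↦ ⟨w, rfl, fun n hn ↦ by rwa [Nat.le_zero.1 hn]⟩
    | succ N ih =>
      intro w hw
      obtain ⟨v, hv, rfl⟩ := hsub N hw
      obtain ⟨x, rfl, hx⟩ := ih v hv
      refine ⟨x, Function.iterate_succ_apply' f N x, fun n hn ↦ ?_⟩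
      rcases Nat.le_succ_iff.1 hn with h | rfl
      · exact hx n h
      · rwa [Function.iterate_succ_apply']
  have hcl : ∀ n, IsClosed (f^[n] ⁻¹' E n) := fun n ↦ (hE n).isClosed.preimage (hf.iterate n)
  obtain ⟨x, hx⟩ := IsCompact.nonempty_iInter_of_sequence_nonempty_isCompact_isClosed
    (fun N ↦ ⋂ n ≤ N, f^[n] ⁻¹' E n)
    (fun N ↦ biInter_subset_biInter_left fun n hn ↦ Nat.le_succ_of_le hn)
    (fun N ↦ by
      obtain ⟨w, hw⟩ := hne N
      obtain ⟨x, -, hx⟩ := hback N w hw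
      exact ⟨x, mem_iInter₂.2 hx⟩)
    ((hE 0).of_isClosed_subset (isClosed_biInter fun n _ ↦ hcl n)
      (biInter_subset_of_mem (Nat.le_refl 0)))
    (fun N ↦ isClosed_biInter fun n _ ↦ hcl n)
  exact ⟨x, fun n ↦ mem_iInter₂.1 (mem_iInter.1 hx n) n le_rfl⟩

/-! ### Escaping orbits in the tract lie in the Julia set -/

/-- Near an escaping point of the Fatou set, the whole sequence of iterates tends to `∞`
uniformly. -/
theorem exists_closedBall_eventually_lt_norm_iterate {f : ℂ → ℂ} {ζ : ℂ} (hF : ζ ∈ fatouSet f)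
    (hI : ζ ∈ escapingSet f) : ∃ δ > 0, ∀ M : ℝ, ∀ᶠ n in atTop,
      ∀ z ∈ Metric.closedBall ζ δ, M < ‖f^[n] z‖ := by
  obtain ⟨U, hU, hζ, hnorm⟩ := hF
  obtain ⟨δ, hδ, hsub⟩ := Metric.nhds_basis_closedBall.mem_iff.1 (hU.mem_nhds hζ)
  refine ⟨δ, hδ, fun M ↦ ?_⟩
  by_contra hcon
  -- Apply normality to a sequence of iterates that violates the claim.
  obtain ⟨φ, hφ, hlow⟩ := extraction_of_frequently_atTop (not_eventually.1 hcon)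
  obtain ⟨θ, hθ, ⟨G, hG⟩ | hinf⟩ := hnorm (fun n ↦ f^[φ n]) (fun n ↦ ⟨φ n, rfl⟩)
  · have h1 : Tendsto (fun n ↦ f^[φ (θ n)] ζ) atTop (𝓝 (G ζ)) :=
      (hG {ζ} (by simpa using hζ) isCompact_singleton).tendsto_at rfl
    have h2 : Tendsto (fun n ↦ f^[φ (θ n)] ζ) atTop (cobounded ℂ) :=
      Tendsto.comp (f := fun n ↦ φ (θ n)) hI (hφ.comp hθ).tendsto_atTop
    exact h2.not_tendsto (Metric.disjoint_cobounded_nhds _) h1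
  · obtain ⟨n, hn⟩ := (hinf _ hsub (isCompact_closedBall ζ δ) M).exists
    exact hlow (θ n) hn

theorem IsDirectTract.subset_of_isPreconnected {f : ℂ → ℂ} {R : ℝ} {D : Set ℂ}
    (hT : IsDirectTract f R D) {B : Set ℂ} (hB : IsPreconnected B) (hne : (B ∩ D).Nonempty)
    (hR : ∀ z ∈ B, R < ‖f z‖) : B ⊆ D := by
  refine hB.subset_left_of_subset_union hT.isOpen isClosed_closure.isOpen_compl
    (disjoint_compl_right.mono_left subset_closure) (fun z hz ↦ ?_) hne
  by_cases hzD : z ∈ D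
  · exact Or.inl hzD
  · refine Or.inr fun hcl ↦ (hR z hz).ne' (hT.norm_eq z ⟨hcl, ?_⟩)
    rwa [hT.isOpen.interior_eq]

theorem deriv_eq_of_exp_comp_eventuallyEq {p q : ℂ → ℂ} {z : ℂ} (hp : DifferentiableAt ℂ p z)
    (hq : DifferentiableAt ℂ q z)
    (h : (fun w ↦ Complex.exp (p w)) =ᶠ[𝓝 z] fun w ↦ Complex.exp (q w)) :
    deriv p z = deriv q z := by
  have h1 := h.deriv_eq
  rw [deriv_cexp hp, deriv_cexp hq, show Complex.exp (p z) = Complex.exp (q z) from h.self_of_nhds]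
    at h1
  exact mul_left_cancel₀ (Complex.exp_ne_zero _) h1

namespace IsLogarithmicCoordinate

variable {f : ℂ → ℂ} {D : Set ℂ} {L : ℝ} {g ψ Φ : ℂ → ℂ}

theorem lt_re_g (h : IsLogarithmicCoordinate f D L g ψ Φ) {z : ℂ} {c : ℝ} (hz : z ∈ D)
    (hc : Real.exp c < ‖f z‖) : c < (g z).re := by
  rwa [← h.exp_g z hz, Complex.norm_exp, Real.exp_lt_exp] at hc

theorem deriv_ne_zero (h : IsLogarithmicCoordinate f D L g ψ Φ) (hD : IsOpen D)
    {z : ℂ} (hz : z ∈ D) (hL : Real.exp L < ‖f z‖) : deriv f z ≠ 0 := by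
  have hg := h.differentiableOn_g.differentiableAt (hD.mem_nhds hz)
  have hgz : L < (g z).re := h.lt_re_g hz hL
  have hΦ := h.differentiableOn_Φ.differentiableAt ((isOpen_setOf_lt_re L).mem_nhds hgz)
  have hgL : ∀ᶠ w in 𝓝 z, L < (g w).re :=
    hg.continuousAt.eventually ((isOpen_setOf_lt_re L).mem_nhds hgz)
  -- `exp ∘ Φ ∘ g` is the identity near `z`.
  have hid : (fun w ↦ Complex.exp (Φ (g w))) =ᶠ[𝓝 z] id := by
    filter_upwards [hgL, hD.mem_nhds hz] with w hw hwD
    rw [h.exp_Φ _ hw, h.ψ_g w hwD, id]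
  have h1 := hid.deriv_eq
  have h2 : deriv (fun w ↦ Φ (g w)) z = deriv Φ (g z) * deriv g z := deriv_comp z hΦ hg
  rw [deriv_cexp (f := fun w ↦ Φ (g w)) (hΦ.comp z hg), h2, deriv_id] at h1
  have hfg : f =ᶠ[𝓝 z] fun w ↦ Complex.exp (g w) := by
    filter_upwards [hD.mem_nhds hz] with w hw using (h.exp_g w hw).symm
  rw [hfg.deriv_eq, deriv_cexp hg]
  refine mul_ne_zero (Complex.exp_ne_zero _) fun h0 ↦ ?_
  rw [h0] at h1
  simp at h1

theorem mem_juliaSet (h : IsLogarithmicCoordinate f D L g ψ Φ) (hf : Differentiable ℂ f) {R : ℝ}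
    (hT : IsDirectTract f R D) {ζ : ℂ} (hI : ζ ∈ escapingSet f) (hζD : ∀ n, f^[n] ζ ∈ D)
    (hζL : ∀ n, Real.exp L < ‖f^[n] ζ‖) : ζ ∈ juliaSet f := by
  intro hF
  obtain ⟨δ, hδ, hinf⟩ := exists_closedBall_eventually_lt_norm_iterate hF hI
  obtain ⟨N, hN⟩ := eventually_atTop.1 (hinf (max R (Real.exp (L + 10000))))
  set B := Metric.ball ζ δ
  have hζB : ζ ∈ B := Metric.mem_ball_self hδ
  have hlarge : ∀ n, N ≤ n → ∀ z ∈ B, max R (Real.exp (L + 10000)) < ‖f (f^[n] z)‖ :=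
    fun n hn z hz ↦ by
      rw [← Function.iterate_succ_apply' f n z]
      exact hN (n + 1) (by omega) z (Metric.ball_subset_closedBall hz)
  have hBD : ∀ n, N ≤ n → MapsTo f^[n] B D := fun n hn ↦ mapsTo_iff_image_subset.2 <|
    hT.subset_of_isPreconnected
      ((convex_ball ζ δ).isPreconnected.image _ (hf.iterate n).continuous.continuousOn)
      ⟨f^[n] ζ, mem_image_of_mem _ hζB, hζD n⟩ (by
        rintro _ ⟨z, hz, rfl⟩
        exact (le_max_left _ _).trans_lt (hlarge n hn z hz))
  have hre : ∀ n, N ≤ n → ∀ z ∈ B, L + 10000 < (g (f^[n] z)).re := fun n hn z hz ↦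
    h.lt_re_g (hBD n hn hz) ((le_max_right _ _).trans_lt (hlarge n hn z hz))
  have hre' : ∀ n, N ≤ n → ∀ z ∈ B, L < (g (f^[n] z)).re := fun n hn z hz ↦ by
    linarith [hre n hn z hz]
  have hGd : ∀ n, N ≤ n → DifferentiableOn ℂ (fun z ↦ g (f^[n] z)) B := fun n hn ↦
    h.differentiableOn_g.comp (hf.iterate n).differentiableOn (hBD n hn)
  -- `K n` is a branch of the logarithm of `f^[n]` on the disc.
  set K : ℕ → ℂ → ℂ := fun n z ↦ Φ (g (f^[n] z)) with hK
  have hKd : ∀ n, N ≤ n → DifferentiableOn ℂ (K n) B := fun n hn ↦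
    h.differentiableOn_Φ.comp (hGd n hn) (hre' n hn)
  have hKexp : ∀ n, N ≤ n → ∀ z ∈ B, Complex.exp (K n z) = f^[n] z := fun n hn z hz ↦ by
    rw [hK, h.exp_Φ _ (hre' n hn z hz), h.ψ_g _ (hBD n hn hz)]
  have hKbound : ∀ n, N ≤ n → ‖deriv (K n) ζ‖ * δ ≤ 1000 := fun n hn ↦ by
    refine norm_deriv_mul_le_of_forall_ne_add_two_pi_I hδ (hKd n hn) fun z hz w hw hzw ↦ ?_
    have h1 : f^[n] w = f^[n] z := by
      rw [← hKexp n hn w hw, hzw, Complex.exp_periodic, hKexp n hn z hz]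
    simp only [hK, h1, left_eq_add] at hzw
    exact Complex.two_pi_I_ne_zero hzw
  have hBn : B ∈ 𝓝 ζ := Metric.ball_mem_nhds ζ hδ
  have hKstep : ∀ n, N ≤ n → ‖deriv (K n) ζ‖ ≤ 1 / 10 * ‖deriv (K (n + 1)) ζ‖ := fun n hn ↦ by
    -- Both `g ∘ f^[n]` and `K (n + 1)` are logarithms of `f^[n + 1]`.
    have hG := (hGd n hn).differentiableAt hBn
    have h1 : deriv (fun z ↦ g (f^[n] z)) ζ = deriv (K (n + 1)) ζ := by
      refine deriv_eq_of_exp_comp_eventuallyEq hG ((hKd (n + 1) (by omega)).differentiableAt hBn) ?_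
      filter_upwards [hBn] with z hz
      rw [h.exp_g _ (hBD n hn hz), hKexp (n + 1) (by omega) z hz, Function.iterate_succ_apply']
    have h2 : deriv (K n) ζ = deriv Φ (g (f^[n] ζ)) * deriv (fun z ↦ g (f^[n] z)) ζ :=
      deriv_comp ζ (h.differentiableOn_Φ.differentiableAt
        ((isOpen_setOf_lt_re L).mem_nhds (hre' n hn ζ hζB))) hG
    rw [h2, h1, norm_mul]
    gcongr
    exact h.norm_deriv_Φ_le_of_le (hre n hn ζ hζB).le
  have hKpow : ∀ k, ‖deriv (K N) ζ‖ ≤ (1 / 10) ^ k * (1000 / δ) := fun k ↦ by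
    have h1 : ∀ k, ‖deriv (K N) ζ‖ ≤ (1 / 10) ^ k * ‖deriv (K (N + k)) ζ‖ := fun k ↦ by
      induction k with
      | zero => simp
      | succ k ih =>
        refine ih.trans ?_
        rw [pow_succ, mul_assoc, ← add_assoc]
        gcongr
        exact hKstep (N + k) (by omega)
    refine (h1 k).trans ?_
    gcongr
    rw [le_div_iff₀ hδ]
    exact hKbound (N + k) (by omega)
  have hK0 : deriv (K N) ζ = 0 := by
    have h1 : Tendsto (fun k : ℕ ↦ (1 / 10 : ℝ) ^ k * (1000 / δ)) atTop (𝓝 0) := by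
      simpa using (tendsto_pow_atTop_nhds_zero_of_lt_one (r := (1 / 10 : ℝ)) (by norm_num)
        (by norm_num)).mul_const (1000 / δ)
    exact norm_le_zero_iff.1 (ge_of_tendsto' h1 hKpow)
  have hiter0 : deriv f^[N] ζ = 0 := by
    have h1 : f^[N] =ᶠ[𝓝 ζ] fun z ↦ Complex.exp (K N z) := by
      filter_upwards [hBn] with z hz using (hKexp N le_rfl z hz).symm
    rw [h1.deriv_eq, deriv_cexp ((hKd N le_rfl).differentiableAt hBn), hK0, mul_zero]
  have hiter : ∀ n, deriv f^[n] ζ ≠ 0 := fun n ↦ by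
    induction n with
    | zero => simp
    | succ n ih =>
      rw [Function.iterate_succ', deriv_comp ζ hf.differentiableAt (hf.iterate n).differentiableAt]
      refine mul_ne_zero (h.deriv_ne_zero hT.isOpen (hζD n) ?_) ih
      rw [← Function.iterate_succ_apply' f n ζ]
      exact hζL (n + 1)
  exact hiter N hiter0

end IsLogarithmicCoordinate

/-! ### Slow escape in the tract -/

theorem theorem1p1 (f : ℂ → ℂ) (hf : IsTranscendentalEntire f)
    (D : Set ℂ) (hD : IsLogarithmicTract f D)
    (a : ℕ → ℝ) (ha_pos : ∀ n, 0 < a n) (ha : Tendsto a atTop atTop) :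
    ∃ ζ ∈ escapingSet f ∩ juliaSet f ∩ closure D, ∃ N : ℕ,
      (∀ n : ℕ, 1 ≤ n → f^[n] ζ ∈ closure D) ∧
      ∀ n : ℕ, N ≤ n → ‖f^[n] ζ‖ ≤ a n := by
  obtain ⟨R, L, g, ψ, Φ, hT, h⟩ := exists_isLogarithmicCoordinate hf.1 hD
  obtain ⟨r₀, hr₀⟩ := h.exists_forall_exists_mem_annulus hf.1
  obtain ⟨r, hr⟩ : ∃ r, r = max r₀ (max R (Real.exp L) + 1) := ⟨_, rfl⟩
  have hrr₀ : r₀ ≤ r := hr ▸ le_max_left _ _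
  have hrm : max R (Real.exp L) < r := (lt_add_one _).trans_le (hr ▸ le_max_right _ _)
  have hrR : R < r := (le_max_left _ _).trans_lt hrm
  have hrL : Real.exp L < r := (le_max_right _ _).trans_lt hrm
  have hr0 : 0 < r := hT.pos.trans hrR
  obtain ⟨m, hm, hmono, hstep, hma⟩ := exists_slow_sequence ha fun k ↦ 2 * (r * 2 ^ k)
  have hρ : ∀ n, r ≤ r * 2 ^ m n := fun n ↦ le_mul_of_one_le_right hr0.le (one_le_pow₀ one_le_two)
  have hρ1 : ∀ n, r * 2 ^ m n ≤ r * 2 ^ m (n + 1) := fun n ↦ by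
    gcongr
    · norm_num
    · exact hmono n.le_succ
  have hρ2 : ∀ n, r * 2 ^ m (n + 1) ≤ 2 * (r * 2 ^ m n) := fun n ↦ by
    calc r * 2 ^ m (n + 1) ≤ r * 2 ^ (m n + 1) := by
          gcongr
          · norm_num
          · exact hstep n
      _ = 2 * (r * 2 ^ m n) := by ring
  let E : ℕ → Set ℂ := fun n ↦ closure D ∩ {z | r * 2 ^ m n ≤ ‖z‖ ∧ ‖z‖ ≤ 2 * (r * 2 ^ m n)}
  have hEc : ∀ n, IsCompact (E n) := fun n ↦ by
    refine (isCompact_closedBall (0 : ℂ) (2 * (r * 2 ^ m n))).of_isClosed_subset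
      (isClosed_closure.inter ((isClosed_le continuous_const continuous_norm).inter
        (isClosed_le continuous_norm continuous_const))) fun z hz ↦ ?_
    simpa using hz.2.2
  have hEne : ∀ n, (E n).Nonempty := fun n ↦ by
    have h0 : ‖((r * 2 ^ m n : ℝ) : ℂ)‖ = r * 2 ^ m n := by
      rw [Complex.norm_real, Real.norm_of_nonneg (hr0.le.trans (hρ n))]
    obtain ⟨z, hzD, h1, h2, -⟩ := hr₀ (r * 2 ^ m n) (hrr₀.trans (hρ n)) (r * 2 ^ m n : ℝ) h0.ge
      (by rw [h0]; linarith [hρ n])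
    exact ⟨z, subset_closure hzD, h1, h2⟩
  have hEsub : ∀ n, E (n + 1) ⊆ f '' E n := fun n w hw ↦ by
    obtain ⟨z, hzD, h1, h2, hzw⟩ := hr₀ (r * 2 ^ m n) (hrr₀.trans (hρ n)) w
      ((hρ1 n).trans hw.2.1) (by linarith [hw.2.2, hρ2 n])
    exact ⟨z, ⟨subset_closure hzD, h1, h2⟩, hzw⟩
  obtain ⟨ζ, hζ⟩ := exists_forall_iterate_mem hf.1.continuous hEc hEne hEsub
  have hnorm : ∀ n, r ≤ ‖f^[n] ζ‖ := fun n ↦ (hρ n).trans (hζ n).2.1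
  have hI : ζ ∈ escapingSet f := by
    refine tendsto_norm_atTop_iff_cobounded.1 (tendsto_atTop_mono (fun n ↦ (hζ n).2.1) ?_)
    exact ((tendsto_pow_atTop_atTop_of_one_lt one_lt_two).comp hm).const_mul_atTop hr0
  have hζD : ∀ n, f^[n] ζ ∈ D := fun n ↦ by
    -- On the boundary of `D` the next iterate would have modulus `R < r`.
    by_contra hn
    have h1 := hT.norm_eq (f^[n] ζ) ⟨(hζ n).1, by rwa [hT.isOpen.interior_eq]⟩
    rw [← Function.iterate_succ_apply' f n ζ] at h1
    linarith [hnorm (n + 1)]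
  obtain ⟨N, hN⟩ := eventually_atTop.1 hma
  exact ⟨ζ, ⟨⟨hI, h.mem_juliaSet hf.1 hT hI hζD fun n ↦ hrL.trans_le (hnorm n)⟩,
    subset_closure (hζD 0)⟩, N, fun n _ ↦ subset_closure (hζD n),
    fun n hn ↦ (hζ n).2.2.trans (hN n hn)⟩
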